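/- Write a permutation of $[n]=\{1,\dots,n\}$ in one-line notation as a word $\pi=\pi(1)\pi(2)\cdots\pi(n)$. Let $\mathbf S$ be Knuth's stack-sorting operator, defined on words with distinct entries by $\mathbf S(\varepsilon)=\varepsilon$ and $\mathbf S(\alpha m\beta)=\mathbf S(\alpha)\,\mathbf S(\beta)\,m$, where $m$ is the largest entry of $\alpha m\beta$, and let $\mathbf R$ be the reversal of words. A permutation $\theta$ of $[n]$ is sorted by an operator $\mathbf B$ if $\mathbf B(\theta)=12\cdots n$. The permutations sorted by $\mathbf S$ are exactly those avoiding the pattern $231$. For permutations $\alpha$ of $[a]$ and $\beta$ of $[b]$ put $\alpha\oplus\beta=\alpha(\beta+a)$ and $\alpha\ominus\beta=(\alpha+b)\beta$. Every nonempty permutation avoiding $231$ is uniquely of the form $\alpha\oplus(1\ominus\beta)$ with $\alpha,\beta$ (possibly empty) avoiding $231$; define $P$ on permutations avoiding $231$ recursively by $P(\varepsilon)=\varepsilon$ and $P(\alpha\oplus(1\ominus\beta))=(P(\alpha)\oplus 1)\ominus P(\beta)$. For $\pi$ avoiding $231$, let $\lambda_\pi$ be the permutation with $P(\pi)=\lambda_\pi\circ\pi$.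 For an operator $\mathbf A$ and $\theta$ sorted by $\mathbf S\circ\mathbf A$, put $\Phi_{\mathbf A}(\theta)=\lambda_{\mathbf A(\theta)}\circ\theta$. **Theorem.** Let $\mathbf A$ be any (possibly empty) composition of the operators $\mathbf S$ and $\mathbf R$, and let $n\ge 0$. Let $X$ and $Y$ be the sets of permutations of $[n]$ sorted by $\mathbf S\circ\mathbf A$ and by $\mathbf S\circ\mathbf R\circ\mathbf A$, respectively. Then $|X|=|Y|$; more precisely, $\Phi_{\mathbf A}$ is a bijection from $X$ to $Y$. Moreover, each of the following statistics is preserved by $\Phi_{\mathbf A}$, and hence equidistributed across $X$ and $Y$: 1. the number and the set of positions of the right-to-left maxima (the $i$ with $\pi(j)<\pi(i)$ for all $j>i$); 2. the number and the set of positions of the left-to-right maxima (the $i$ with $\pi(j)<\pi(i)$ for all $j<i$); 3. the up-down word $w_\pi\in\{u,d\}^{n-1}$ (the empty word if $n=0$), where $w_\pi(i)=u$ if $\pi(i)<\pi(i+1)$ and $w_\pi(i)=d$ if $\pi(i)>\pi(i+1)$, and hence every statistic of permutations of $[n]$ that is determined by the up-down word; 4. if $\mathbf A=\mathbf A_0\circ\mathbf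 S$ for some composition $\mathbf A_0$ of $\mathbf S$ and $\mathbf R$: the statistic $\mathrm{zeil}(\pi)=\max\{k\le n : n(n-1)\cdots(n-k+1)\text{ is a (not necessarily contiguous) subword of }\pi\}$; 5. if $\mathbf A=\mathbf B_0\circ\mathbf S\circ\mathbf R\circ\mathbf S^k$ for some composition $\mathbf B_0$ of $\mathbf S$ and $\mathbf R$ and some $k\ge1$: the statistic $\mathrm{Rzeil}(\pi)=\max\{j\le n : (n-j+1)\cdots(n-1)n\text{ is a (not necessarily contiguous) subword of }\pi\}$. -/

import Mathlib

namespace StackSorting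

/-! Permutations are handled in one-line notation: the permutation `π` of `[n] = {1, …, n}` is the
word `π(1) π(2) … π(n)`, a list of natural numbers. -/

/-- `w` is the one-line notation of a permutation of `{1, …, n}`. -/
def IsPermutation (n : ℕ) (w : List ℕ) : Prop :=
  w.Perm (List.range' 1 n)

/-- The largest entry of a word. -/
def maxEntry (w : List ℕ) : ℕ :=
  w.foldr max 0

/-- The factor `α` in the decomposition `w = α m β` of a word at its largest entry `m`. -/
def beforeMax (w : List ℕ) : List ℕ :=
  w.take (w.idxOf (maxEntry w))

/-- The factor `β` in the decomposition `w = α m β` of a word at its largest entry `m`. -/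
def afterMax (w : List ℕ) : List ℕ :=
  w.drop (w.idxOf (maxEntry w) + 1)

theorem maxEntry_mem (a : ℕ) (l : List ℕ) : maxEntry (a :: l) ∈ a :: l := by
  induction l generalizing a with
  | nil => simp [maxEntry]
  | cons b l ih =>
    have h : maxEntry (a :: b :: l) = max a (maxEntry (b :: l)) := rfl
    rcases max_choice a (maxEntry (b :: l)) with h' | h'
    · rw [h, h']; exact List.mem_cons_self
    · rw [h, h']; exact List.mem_cons_of_mem _ (ih b)

theorem beforeMax_length_lt (a : ℕ) (l : List ℕ) :
    (beforeMax (a :: l)).length < (a :: l).length := by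
  have h := List.idxOf_lt_length_of_mem (maxEntry_mem a l)
  rw [beforeMax, List.length_take]
  exact lt_of_le_of_lt (min_le_left _ _) h

theorem afterMax_length_lt (a : ℕ) (l : List ℕ) :
    (afterMax (a :: l)).length < (a :: l).length := by
  rw [afterMax, List.length_drop]
  have : 0 < (a :: l).length := Nat.succ_pos _
  omega

/-- Knuth's stack-sorting operator: `S(ε) = ε` and `S(α m β) = S(α) S(β) m`, where `m` is the
largest entry of the word `α m β`. -/
def stackSort : List ℕ → List ℕ
  | [] => []
  | a :: l =>
      stackSort (beforeMax (a :: l)) ++ stackSort (afterMax (a :: l)) ++ [maxEntry (a :: l)]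
termination_by w => w.length
decreasing_by
  · exact beforeMax_length_lt a l
  · exact afterMax_length_lt a l

/-- The reversal operator. -/
def reversal (w : List ℕ) : List ℕ :=
  w.reverse

/-- `A` is a (possibly empty) composition of the operators `S` and `R`. -/
inductive IsComposition : (List ℕ → List ℕ) → Prop
  | identity : IsComposition id
  | stackSort_comp {A : List ℕ → List ℕ} : IsComposition A → IsComposition (stackSort ∘ A)
  | reversal_comp {A : List ℕ → List ℕ} : IsComposition A → IsComposition (reversal ∘ A)

/-- The set of permutations of `{1, …, n}` that are sorted by `B`, i.e. sent by `B` to `1 2 … n`. -/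
def sortedBy (n : ℕ) (B : List ℕ → List ℕ) : Set (List ℕ) :=
  {θ | IsPermutation n θ ∧ B θ = List.range' 1 n}

theorem sortedBy_finite (n : ℕ) (B : List ℕ → List ℕ) : (sortedBy n B).Finite := by
  refine ((List.range' 1 n).permutations.toFinset.finite_toSet).subset ?_
  rintro θ ⟨h, -⟩
  simpa [IsPermutation] using h

/-- The sum `α ⊕ β = α (β + |α|)` of two permutations. -/
def directSum (α β : List ℕ) : List ℕ :=
  α ++ β.map (· + α.length)

/-- The skew sum `α ⊖ β = (α + |β|) β` of two permutations. -/
def skewSum (α β : List ℕ) : List ℕ :=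
  α.map (· + β.length) ++ β

/-- The map `P`: `P(ε) = ε`, and if `π = α ⊕ (1 ⊖ β)` then `P(π) = (P(α) ⊕ 1) ⊖ P(β)`.
A nonempty permutation `π` avoiding `231` is of the form `α ⊕ (1 ⊖ β)` in exactly one way: `α` is
what precedes the largest entry of `π`, and `β` is what follows it, lowered by `|α|`.
Only the values of `P` on permutations avoiding `231` are meaningful. -/
def bijP : List ℕ → List ℕ
  | [] => []
  | a :: l =>
      skewSum (directSum (bijP (beforeMax (a :: l))) [1])
        (bijP ((afterMax (a :: l)).map (· - (beforeMax (a :: l)).length)))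
termination_by w => w.length
decreasing_by
  · exact beforeMax_length_lt a l
  · rw [List.length_map]; exact afterMax_length_lt a l

/-- The relabeling `λ_π` of the entries of `π`, determined by `P(π) = λ_π ∘ π`: the value that
stands in `π` at some position is sent to the value that stands in `P(π)` at that position. -/
def relabeling (π : List ℕ) (x : ℕ) : ℕ :=
  (bijP π).getD (π.idxOf x) 0

/-- The map `Φ_A`, given by `Φ_A(θ) = λ_{A(θ)} ∘ θ`. -/
def Phi (A : List ℕ → List ℕ) (θ : List ℕ) : List ℕ :=
  θ.map (relabeling (A θ))

/-- The entry `π(i)`, for a position `1 ≤ i ≤ |π|`. -/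
def entry (π : List ℕ) (i : ℕ) : ℕ :=
  π.getD (i - 1) 0

/-- The positions of the left-to-right maxima. -/
def lrMaxPositions (π : List ℕ) : Finset ℕ :=
  {i ∈ Finset.Icc 1 π.length | ∀ j < i, 1 ≤ j → entry π j < entry π i}

/-- The positions of the right-to-left maxima. -/
def rlMaxPositions (π : List ℕ) : Finset ℕ :=
  {i ∈ Finset.Icc 1 π.length | ∀ j ≤ π.length, i < j → entry π j < entry π i}

/-- The number of left-to-right maxima. -/
def lrMaxCount (π : List ℕ) : ℕ :=
  (lrMaxPositions π).card

/-- The number of right-to-left maxima. -/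
def rlMaxCount (π : List ℕ) : ℕ :=
  (rlMaxPositions π).card

/-- The letters of up-down words. -/
inductive UpDown
  | u
  | d

/-- The up-down word: its `i`-th letter, for `1 ≤ i < |π|`, is `u` if `π(i) < π(i+1)`, and `d`
otherwise. -/
def upDownWord (π : List ℕ) : List UpDown :=
  (List.range' 1 (π.length - 1)).map
    fun i => if entry π i < entry π (i + 1) then UpDown.u else UpDown.d

/-- `zeil(π)`, for a permutation `π` of `{1, …, n}`: the largest `k ≤ n` such that
`n (n-1) … (n-k+1)` is a (not necessarily contiguous) subword of `π`. -/
def zeil (π : List ℕ) : ℕ :=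
  Nat.findGreatest
    (fun k => ((List.range' (π.length - k + 1) k).reverse).Sublist π) π.length

/-- `Rzeil(π)`, for a permutation `π` of `{1, …, n}`: the largest `k ≤ n` such that
`(n-k+1) … (n-1) n` is a (not necessarily contiguous) subword of `π`. -/
def Rzeil (π : List ℕ) : ℕ :=
  Nat.findGreatest (fun k => (List.range' (π.length - k + 1) k).Sublist π) π.length

/-- The statistic `f` has the same distribution on `X` and on `Y`. -/
def Equidistributed {T : Type*} (f : List ℕ → T) (X Y : Set (List ℕ)) : Prop :=
  ∀ v : T, {θ ∈ X | f θ = v}.ncard = {θ ∈ Y | f θ = v}.ncard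

/-- The statistic `f` is preserved by `F` on `X`. -/
def PreservedBy {T : Type*} (F : List ℕ → List ℕ) (f : List ℕ → T) (X : Set (List ℕ)) : Prop :=
  ∀ θ ∈ X, f (F θ) = f θ

/-- The statistic `f` is equidistributed across the permutations of `{1, …, n}` sorted by `S ∘ A`
and those sorted by `S ∘ R ∘ A`, and it is preserved by `Φ_A`. -/
def Transferred {T : Type*} (n : ℕ) (A : List ℕ → List ℕ) (f : List ℕ → T) : Prop :=
  Equidistributed f (sortedBy n (stackSort ∘ A)) (sortedBy n (stackSort ∘ reversal ∘ A)) ∧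
    PreservedBy (Phi A) f (sortedBy n (stackSort ∘ A))

end StackSorting

/-!
Split a word at its largest entry, and the factors again, and so on: this builds its decreasing
binary tree. `S` reads the tree in postorder, so `S` commutes with every relabeling of the entries
that keeps the shape of the tree. Conversely, a relabeling that keeps the shape of the tree of
`S(w)` keeps that of `w`, because `S(w) = S(α) S(β) m` records that `m` is largest, and `S(α)` and
`S(β)` are factors. Reversal mirrors trees and is harmless, so both facts pass from `S` to every
composition `A`.

The decompositions `α ⊕ (1 ⊖ β)` and `(P(α) ⊕ 1) ⊖ P(β)` have their largest entries at the same
position, so `P` does not change the shape of the tree, and it maps the permutations sorted by `S`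
bijectively to those sorted by `S ∘ R`. Hence `λ` pulls back along `A`: `A(Φ(θ)) = P(A(θ))`, and
`Φ(θ)` has the same shape as `θ`. The former makes `Φ` a bijection, the latter preserves the maxima
and the up-down word, which depend on the shape only.

If the `k` largest entries decrease in `w`, then `S(w)` ends in them, in increasing order. A
permutation of the same shape as `S(w)` ends in them as well, so a relabeling that keeps this shape
fixes them: this gives `zeil`. Since `S` keeps increasing subwords and `R` makes them decreasing,
the same argument applied to `R(S^k(θ))` gives `Rzeil`.
-/

namespace StackSorting

section Words

variable {α : Type*}

theorem append_cons_inj_of_lt [Preorder α] {u v u' v' : List α} {m m' : α}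
    (h : u ++ m :: v = u' ++ m' :: v') (hm : ∀ y ∈ u ++ v, y < m) (hm' : ∀ y ∈ u' ++ v', y < m') :
    u = u' ∧ m = m' ∧ v = v' := by
  rcases List.append_eq_append_iff.1 h with ⟨_ | ⟨x, t⟩, rfl, ht⟩ | ⟨_ | ⟨x, t⟩, rfl, ht⟩
  · simpa using ht
  · obtain ⟨rfl, rfl⟩ : m = x ∧ v = t ++ m' :: v' := by simpa using ht
    exact absurd (hm m' (by simp)) (hm' m (by simp)).asymm
  · simpa [eq_comm] using ht
  · obtain ⟨rfl, rfl⟩ : m' = x ∧ v' = t ++ m :: v := by simpa using ht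
    exact absurd (hm m' (by simp)) (hm' m (by simp)).asymm

theorem exists_eq_append_cons_of_nodup [LinearOrder α] {w : List α} (hw : w.Nodup) (hne : w ≠ []) :
    ∃ u m v, w = u ++ m :: v ∧ ∀ y ∈ u ++ v, y < m := by
  obtain ⟨u, v, huv⟩ := List.append_of_mem (List.max_mem hne)
  have hle : ∀ y ∈ w, y ≤ w.max hne := fun y hy => List.le_max_of_mem hy
  generalize w.max hne = m at huv hle
  subst huv
  have hm : m ∉ u ++ v := (List.nodup_cons.1 (List.nodup_middle.1 hw)).1
  refine ⟨u, m, v, rfl, fun y hy => lt_of_le_of_ne (hle y ?_) (ne_of_mem_of_not_mem hy hm)⟩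
  rw [List.mem_append] at hy ⊢
  exact hy.imp_right (List.mem_cons_of_mem m)

theorem maxDecomposition_induction [LinearOrder α] {motive : (w : List α) → w.Nodup → Prop}
    (nil : motive [] List.nodup_nil)
    (node : ∀ u m v, (hw : (u ++ m :: v).Nodup) → (∀ y ∈ u ++ v, y < m) →
      motive u hw.of_append_left → motive v hw.of_append_right.of_cons → motive (u ++ m :: v) hw)
    (w : List α) (hw : w.Nodup) : motive w hw := by
  induction hn : w.length using Nat.strong_induction_on generalizing w with
  | _ n ih =>
    rcases eq_or_ne w [] with rfl | hne
    · exact nil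
    obtain ⟨u, m, v, rfl, hm⟩ := exists_eq_append_cons_of_nodup hw hne
    have hlen : u.length + (v.length + 1) = n := by simpa using hn
    exact node u m v hw hm (ih _ (by omega) u _ rfl) (ih _ (by omega) v _ rfl)

theorem exists_leftInvOn_of_nodup_map {β : Type*} [Nonempty α] {f : α → β} {w : List α}
    (h : (w.map f).Nodup) : ∃ g : β → α, Set.LeftInvOn g f {x | x ∈ w} :=
  have hf : Set.InjOn f {x | x ∈ w} := fun _ hx _ hy => List.inj_on_of_nodup_map h hx hy
  ⟨Function.invFunOn f {x | x ∈ w}, hf.leftInvOn_invFunOn⟩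

theorem map_map_of_leftInvOn {β : Type*} {f : α → β} {g : β → α} {w : List α}
    (h : Set.LeftInvOn g f {x | x ∈ w}) : (w.map f).map g = w := by
  rw [List.map_map]
  exact (List.map_congr_left h).trans w.map_id

theorem sublist_of_cons_sublist_append_cons {l u v : List α} {a : α} (hu : a ∉ u)
    (h : (a :: l).Sublist (u ++ a :: v)) : l.Sublist v := by
  induction u with
  | nil => exact List.cons_sublist_cons.1 h
  | cons x u ih =>
    rw [List.mem_cons, not_or] at hu
    rcases List.sublist_cons_iff.1 h with h | ⟨_, hx, _⟩
    · exact ih hu.2 h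
    · exact absurd (List.cons.inj hx).1 hu.1

end Words

/-- `w` and `w'` have decreasing binary trees of the same shape: when both words are split at their
largest entries, and the two factors again, and so on, the largest entries stand at the same
positions at every stage. A word in which some stage has no unique largest entry has no such tree
and is not related to any word. -/
inductive SameShape {α β : Type*} [LT α] [LT β] : List α → List β → Prop
  | nil : SameShape [] []
  | node {u v : List α} {u' v' : List β} {m : α} {m' : β} : SameShape u u' → SameShape v v' →
      (∀ y ∈ u ++ v, y < m) → (∀ y ∈ u' ++ v', y < m') → SameShape (u ++ m :: v) (u' ++ m' :: v')

namespace SameShape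

section LT

variable {α β : Type*} [LT α] [LT β] {w : List α} {w' : List β}

theorem symm (h : SameShape w w') : SameShape w' w := by
  induction h with
  | nil => exact nil
  | node _ _ hm hm' ihu ihv => exact node ihu ihv hm' hm

theorem length_eq (h : SameShape w w') : w.length = w'.length := by
  induction h with
  | nil => rfl
  | node _ _ _ _ ihu ihv => simp only [List.length_append, List.length_cons, ihu, ihv]

theorem reverse (h : SameShape w w') : SameShape w.reverse w'.reverse := by
  induction h with
  | nil => exact nil
  | node _ _ hm hm' ihu ihv =>
    simp only [List.reverse_append, List.reverse_cons, List.append_assoc, List.singleton_append]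
    exact node ihv ihu (by simpa [or_comm] using hm) (by simpa [or_comm] using hm')

theorem take (h : SameShape w w') (k : ℕ) : SameShape (w.take k) (w'.take k) := by
  induction h generalizing k with
  | nil => simpa only [List.take_nil] using nil
  | @node u v u' v' m m' hu _ hm hm' ihu ihv =>
    rcases le_or_gt k u.length with hk | hk
    · rw [List.take_append_of_le_length hk, List.take_append_of_le_length (hu.length_eq ▸ hk)]
      exact ihu k
    · obtain ⟨j, rfl⟩ := Nat.exists_eq_add_of_lt hk
      rw [add_assoc, List.take_length_add_append, hu.length_eq, List.take_length_add_append]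
      refine node hu (ihv j) (fun y hy => hm y ?_) fun y hy => hm' y ?_ <;>
      · rw [List.mem_append] at hy ⊢
        exact hy.imp_right List.mem_of_mem_take

theorem drop (h : SameShape w w') (k : ℕ) : SameShape (w.drop k) (w'.drop k) := by
  have := (h.reverse.take (w.length - k)).reverse
  rwa [← List.reverse_drop, h.length_eq, ← List.reverse_drop, List.reverse_reverse,
    List.reverse_reverse] at this

theorem of_append {u v : List α} {u' v' : List β} (h : SameShape (u ++ v) (u' ++ v'))
    (hl : u.length = u'.length) : SameShape u u' ∧ SameShape v v' :=
  ⟨by simpa [hl] using h.take u.length, by simpa [hl] using h.drop u.length⟩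

end LT

section Preorder

variable {α β γ : Type*} [Preorder α] [Preorder β] [Preorder γ]

theorem lt_head {u : List α} {u' : List β} {x : α} {x' : β} (h : SameShape (x :: u) (x' :: u'))
    (hx : ∀ y ∈ u, y < x) : ∀ y ∈ u', y < x' := by
  generalize hw : x :: u = w, hw' : x' :: u' = w' at h
  cases h with
  | nil => simp at hw
  | @node s t s' t' m m' hs ht hm hm' =>
    rcases s with _ | ⟨z, s⟩
    · obtain rfl : s' = [] := List.eq_nil_of_length_eq_zero hs.length_eq.symm
      obtain ⟨rfl, rfl⟩ := List.cons.inj hw'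
      exact hm'
    · obtain ⟨rfl, rfl⟩ := List.cons.inj hw
      exact absurd (hx m (by simp)) (hm x (by simp)).asymm

theorem lt_head_iff {u : List α} {u' : List β} {x : α} {x' : β}
    (h : SameShape (x :: u) (x' :: u')) : (∀ y ∈ u, y < x) ↔ ∀ y ∈ u', y < x' :=
  ⟨h.lt_head, h.symm.lt_head⟩

theorem lt_last_iff {u : List α} {u' : List β} {x : α} {x' : β}
    (h : SameShape (u ++ [x]) (u' ++ [x'])) : (∀ y ∈ u, y < x) ↔ ∀ y ∈ u', y < x' := by
  have h := h.reverse
  rw [List.reverse_concat, List.reverse_concat] at h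
  simpa only [List.mem_reverse] using h.lt_head_iff

theorem map_right {w : List α} {w' : List β} {f : β → γ} (hf : StrictMono f)
    (h : SameShape w w') : SameShape w (w'.map f) := by
  induction h with
  | nil => exact nil
  | node _ _ hm hm' ihu ihv =>
    rw [List.map_append, List.map_cons]
    refine node ihu ihv hm ?_
    rw [← List.map_append]
    exact List.forall_mem_map.2 fun y hy => hf (hm' y hy)

end Preorder

theorem refl {α : Type*} [LinearOrder α] {w : List α} (hw : w.Nodup) : SameShape w w := by
  induction w, hw using maxDecomposition_induction with
  | nil => exact nil
  | node u m v _ hm ihu ihv => exact node ihu ihv hm hm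

end SameShape

theorem beforeMax_append_maxEntry_cons_afterMax (a : ℕ) (l : List ℕ) :
    beforeMax (a :: l) ++ maxEntry (a :: l) :: afterMax (a :: l) = a :: l := by
  have h := List.idxOf_lt_length_of_mem (maxEntry_mem a l)
  have hdrop := List.drop_eq_getElem_cons h
  rw [List.getElem_idxOf] at hdrop
  rw [beforeMax, afterMax, ← hdrop, List.take_append_drop]

section Decomposition

variable {u v : List ℕ} {m : ℕ}

theorem maxEntry_append_cons (hm : ∀ y ∈ u ++ v, y < m) : maxEntry (u ++ m :: v) = m := by
  refine le_antisymm (List.max_le_of_forall_le _ _ fun y hy => ?_)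
    (List.le_max_of_le (by simp) le_rfl)
  rcases List.mem_cons.1 (List.perm_middle.mem_iff.1 hy) with rfl | hy
  · exact le_rfl
  · exact (hm y hy).le

theorem idxOf_append_cons (hm : ∀ y ∈ u ++ v, y < m) : (u ++ m :: v).idxOf m = u.length := by
  rw [List.idxOf_append_of_notMem fun h => (hm m (List.mem_append_left v h)).false,
    List.idxOf_cons_self, add_zero]

theorem beforeMax_append_cons (hm : ∀ y ∈ u ++ v, y < m) : beforeMax (u ++ m :: v) = u := by
  rw [beforeMax, maxEntry_append_cons hm, idxOf_append_cons hm, List.take_left]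

theorem afterMax_append_cons (hm : ∀ y ∈ u ++ v, y < m) : afterMax (u ++ m :: v) = v := by
  rw [afterMax, maxEntry_append_cons hm, idxOf_append_cons hm, List.drop_length_add_append,
    List.drop_one, List.tail_cons]

theorem stackSort_nil : stackSort [] = [] := by
  rw [stackSort]

theorem stackSort_append_cons (hm : ∀ y ∈ u ++ v, y < m) :
    stackSort (u ++ m :: v) = stackSort u ++ stackSort v ++ [m] := by
  obtain ⟨a, l, h⟩ := List.exists_cons_of_ne_nil (List.append_ne_nil_of_right_ne_nil u
    (List.cons_ne_nil m v))
  rw [h, stackSort, ← h, beforeMax_append_cons hm, afterMax_append_cons hm,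
    maxEntry_append_cons hm]

theorem bijP_nil : bijP [] = [] := by
  rw [bijP]

theorem bijP_append_cons (hm : ∀ y ∈ u ++ v, y < m) :
    bijP (u ++ m :: v) = skewSum (directSum (bijP u) [1]) (bijP (v.map (· - u.length))) := by
  obtain ⟨a, l, h⟩ := List.exists_cons_of_ne_nil (List.append_ne_nil_of_right_ne_nil u
    (List.cons_ne_nil m v))
  rw [h, bijP, ← h, beforeMax_append_cons hm, afterMax_append_cons hm]

end Decomposition

theorem stackSort_perm (w : List ℕ) : (stackSort w).Perm w := by
  induction w using stackSort.induct with
  | case1 => rw [stackSort_nil]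
  | case2 a l ih₁ ih₂ =>
    rw [stackSort, List.append_assoc]
    conv_rhs => rw [← beforeMax_append_maxEntry_cons_afterMax a l]
    exact ih₁.append ((List.perm_append_singleton _ _).trans (ih₂.cons _))

theorem length_stackSort (w : List ℕ) : (stackSort w).length = w.length :=
  (stackSort_perm w).length_eq

theorem mem_stackSort {w : List ℕ} {y : ℕ} : y ∈ stackSort w ↔ y ∈ w :=
  (stackSort_perm w).mem_iff

namespace SameShape

variable {w w' : List ℕ} {f : ℕ → ℕ}

theorem stackSort_map (h : SameShape w (w.map f)) :
    stackSort (w.map f) = (stackSort w).map f := by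
  generalize hw' : w.map f = w' at h
  induction h with
  | nil => rw [stackSort_nil, List.map_nil]
  | @node u v u' v' m m' hu hv hm hm' ihu ihv =>
    rw [List.map_append, List.map_cons] at hw'
    obtain ⟨rfl, hv'⟩ := List.append_inj hw' (by rw [List.length_map, hu.length_eq])
    obtain ⟨rfl, rfl⟩ := List.cons.inj hv'
    rw [stackSort_append_cons hm', stackSort_append_cons hm, ihu rfl, ihv rfl, List.map_append,
      List.map_append, List.map_singleton]

theorem of_stackSort_map (hw : w.Nodup) (h : SameShape (stackSort w) ((stackSort w).map f)) :
    SameShape w (w.map f) := by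
  induction w, hw using maxDecomposition_induction with
  | nil => exact nil
  | node u m v _ hm ihu ihv =>
    rw [stackSort_append_cons hm, List.map_append, List.map_singleton] at h
    have hlast : ∀ y ∈ (stackSort u ++ stackSort v).map f, y < f m := by
      rw [← h.lt_last_iff]
      simpa only [List.mem_append, mem_stackSort] using hm
    have hinit := (h.of_append (List.length_map f).symm).1
    rw [List.map_append] at hinit
    obtain ⟨hu, hv⟩ := hinit.of_append (List.length_map f).symm
    rw [List.map_append, List.map_cons]
    refine node (ihu hu) (ihv hv) hm ?_
    simpa only [List.mem_append, List.mem_map, mem_stackSort, ← List.map_append] using hlast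

end SameShape

theorem stackSort_map_of_strictMono {w : List ℕ} {f : ℕ → ℕ} (hf : StrictMono f) (hw : w.Nodup) :
    stackSort (w.map f) = (stackSort w).map f :=
  ((SameShape.refl hw).map_right hf).stackSort_map

namespace IsComposition

variable {A B : List ℕ → List ℕ} {w : List ℕ} {f : ℕ → ℕ}

theorem comp (hA : IsComposition A) (hB : IsComposition B) : IsComposition (A ∘ B) := by
  induction hA with
  | identity => exact hB
  | stackSort_comp _ ih => exact ih.stackSort_comp
  | reversal_comp _ ih => exact ih.reversal_comp

theorem iterate (hA : IsComposition A) (k : ℕ) : IsComposition A^[k] := by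
  induction k with
  | zero => exact identity
  | succ k ih => exact ih.comp hA

theorem perm (hA : IsComposition A) (w : List ℕ) : (A w).Perm w := by
  induction hA with
  | identity => exact .rfl
  | stackSort_comp _ ih => exact (stackSort_perm _).trans ih
  | reversal_comp _ ih => exact (List.reverse_perm _).trans ih

theorem nodup_apply (hA : IsComposition A) (hw : w.Nodup) : (A w).Nodup :=
  (hA.perm w).nodup_iff.2 hw

theorem sameShape_of_apply (hA : IsComposition A) (hw : w.Nodup)
    (h : SameShape (A w) ((A w).map f)) : SameShape w (w.map f) := by
  induction hA with
  | identity => exact h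
  | stackSort_comp hA ih => exact ih (.of_stackSort_map (hA.nodup_apply hw) h)
  | reversal_comp _ ih => exact ih (by simpa [reversal] using h.reverse)

theorem apply_map (hA : IsComposition A) (hw : w.Nodup) (h : SameShape (A w) ((A w).map f)) :
    A (w.map f) = (A w).map f := by
  induction hA with
  | identity => rfl
  | stackSort_comp hA ih =>
    have hs := SameShape.of_stackSort_map (hA.nodup_apply hw) h
    rw [Function.comp_apply, ih hs, hs.stackSort_map, Function.comp_apply]
  | reversal_comp _ ih =>
    rw [Function.comp_apply, ih (by simpa [reversal] using h.reverse), reversal,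
      Function.comp_apply, reversal, List.map_reverse]

end IsComposition

namespace IsPermutation

variable {n : ℕ} {w : List ℕ}

theorem nodup (h : IsPermutation n w) : w.Nodup :=
  h.nodup_iff.2 List.nodup_range'

theorem length_eq (h : IsPermutation n w) : w.length = n := by
  simpa using List.Perm.length_eq h

theorem le_of_mem {y : ℕ} (h : IsPermutation n w) (hy : y ∈ w) : y ≤ n := by
  have := List.mem_range'_1.1 (h.mem_iff.1 hy)
  omega

theorem append_singleton_iff {u : List ℕ} :
    IsPermutation (n + 1) (u ++ [n + 1]) ↔ IsPermutation n u := by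
  rw [IsPermutation, List.range'_concat, one_mul, add_comm 1 n, List.perm_append_right_iff,
    IsPermutation]

theorem eq_of_forall_lt {x : ℕ} {u : List ℕ} (h : IsPermutation (n + 1) (u ++ [x]))
    (hx : ∀ y ∈ u, y < x) : x = n + 1 := by
  refine le_antisymm (h.le_of_mem (by simp)) ?_
  have hn : n + 1 ∈ u ++ [x] := h.mem_iff.2 (List.mem_range'_1.2 (by omega))
  rcases List.mem_append.1 hn with hn | hn
  · exact (hx _ hn).le
  · exact (List.mem_singleton.1 hn).le

end IsPermutation

theorem reverse_directSum (u v : List ℕ) :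
    (directSum u v).reverse = skewSum v.reverse u.reverse := by
  simp [directSum, skewSum, List.map_reverse]

theorem reverse_skewSum (u v : List ℕ) :
    (skewSum u v).reverse = directSum v.reverse u.reverse := by
  simp [directSum, skewSum, List.map_reverse]

theorem directSum_skewSum_singleton (u v : List ℕ) :
    directSum u (skewSum [1] v) =
      u ++ (u.length + v.length + 1) :: v.map (· + u.length) := by
  simp only [directSum, skewSum, List.map_cons, List.map_nil, List.singleton_append]
  congr 2
  omega

theorem skewSum_directSum_singleton (u v : List ℕ) :
    skewSum (directSum u [1]) v =
      u.map (· + v.length) ++ (u.length + v.length + 1) :: v := by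
  simp only [directSum, skewSum, List.map_append, List.map_cons, List.map_nil,
    List.append_assoc, List.singleton_append]
  congr 2
  omega

/-- The permutations avoiding `231`, built along their decomposition `α ⊕ (1 ⊖ β)`; these are the
permutations sorted by `S`, see `isStackSortable_iff`. -/
inductive IsStackSortable : List ℕ → Prop
  | nil : IsStackSortable []
  | sum {u v : List ℕ} : IsStackSortable u → IsStackSortable v →
      IsStackSortable (directSum u (skewSum [1] v))

section Bounds

variable {u v : List ℕ} (hu : ∀ y ∈ u, y ≤ u.length) (hv : ∀ y ∈ v, y ≤ v.length)
include hu hv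

theorem lt_of_mem_directSum_skewSum_singleton :
    ∀ y ∈ u ++ v.map (· + u.length), y < u.length + v.length + 1 := by
  simp only [List.forall_mem_append, List.forall_mem_map]
  exact ⟨fun y hy => by have := hu y hy; omega, fun y hy => by have := hv y hy; omega⟩

theorem lt_of_mem_skewSum_directSum_singleton :
    ∀ y ∈ u.map (· + v.length) ++ v, y < u.length + v.length + 1 := by
  simp only [List.forall_mem_append, List.forall_mem_map]
  exact ⟨fun y hy => by have := hu y hy; omega, fun y hy => by have := hv y hy; omega⟩

theorem stackSort_directSum_skewSum_singleton (hvn : v.Nodup) :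
    stackSort (directSum u (skewSum [1] v)) =
      directSum (stackSort u) (stackSort v) ++ [u.length + v.length + 1] := by
  rw [directSum_skewSum_singleton,
    stackSort_append_cons (lt_of_mem_directSum_skewSum_singleton hu hv),
    stackSort_map_of_strictMono add_left_strictMono hvn, directSum, length_stackSort]

theorem bijP_directSum_skewSum_singleton :
    bijP (directSum u (skewSum [1] v)) = skewSum (directSum (bijP u) [1]) (bijP v) := by
  rw [directSum_skewSum_singleton, bijP_append_cons (lt_of_mem_directSum_skewSum_singleton hu hv),
    map_map_of_leftInvOn fun y _ => Nat.add_sub_cancel y u.length]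

theorem skewSum_directSum_singleton_inj {u' v' : List ℕ} (hu' : ∀ y ∈ u', y ≤ u'.length)
    (hv' : ∀ y ∈ v', y ≤ v'.length)
    (h : skewSum (directSum u [1]) v = skewSum (directSum u' [1]) v') : u = u' ∧ v = v' := by
  rw [skewSum_directSum_singleton, skewSum_directSum_singleton] at h
  obtain ⟨huu', -, rfl⟩ := append_cons_inj_of_lt h (lt_of_mem_skewSum_directSum_singleton hu hv)
    (lt_of_mem_skewSum_directSum_singleton hu' hv')
  exact ⟨List.map_injective_iff.2 (add_left_injective _) huu', rfl⟩

theorem SameShape.directSum_skewSum {u' v' : List ℕ} (hu' : ∀ y ∈ u', y ≤ u'.length)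
    (hv' : ∀ y ∈ v', y ≤ v'.length) (huu' : SameShape u u') (hvv' : SameShape v v') :
    SameShape (directSum u (skewSum [1] v)) (skewSum (directSum u' [1]) v') := by
  rw [directSum_skewSum_singleton, skewSum_directSum_singleton]
  exact .node (huu'.map_right add_left_strictMono) (hvv'.symm.map_right add_left_strictMono).symm
    (lt_of_mem_directSum_skewSum_singleton hu hv)
    (lt_of_mem_skewSum_directSum_singleton hu' hv')

end Bounds

theorem range'_eq_directSum_append (a b : ℕ) :
    List.range' 1 (a + b + 1) =
      directSum (List.range' 1 a) (List.range' 1 b) ++ [a + b + 1] := by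
  have hshift : (List.range' 1 b).map (· + a) = List.range' (1 + a) b := by
    simpa only [add_comm] using List.map_add_range' (a := a) 1 b 1
  rw [List.range'_concat, directSum, List.length_range', hshift, List.range'_append_1, one_mul,
    add_comm 1]

theorem exists_isStackSortable_of_stackSort_eq {w : List ℕ} {s : ℕ}
    (h : stackSort w = List.range' (s + 1) w.length) :
    ∃ v, IsStackSortable v ∧ w = v.map (· + s) := by
  have hw : w.Nodup := (stackSort_perm w).nodup_iff.1 (h ▸ List.nodup_range')
  induction w, hw using maxDecomposition_induction generalizing s with
  | nil => exact ⟨[], .nil, rfl⟩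
  | node u m v _ hm ihu ihv =>
    rw [stackSort_append_cons hm, List.length_append, List.length_cons, ← add_assoc,
      List.range'_concat, ← List.range'_append_1] at h
    obtain ⟨hinit, hlast⟩ := List.append_inj' h rfl
    obtain ⟨hu, hv⟩ := List.append_inj hinit (by rw [length_stackSort, List.length_range'])
    rw [add_right_comm] at hv
    obtain ⟨u', hu', rfl⟩ := ihu hu
    obtain ⟨v', hv', rfl⟩ := ihv hv
    obtain rfl : m = u'.length + v'.length + 1 + s := by
      simp only [List.length_map, List.cons.injEq] at hlast
      omega
    refine ⟨_, .sum hu' hv', ?_⟩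
    rw [directSum_skewSum_singleton]
    simp only [List.length_map, List.map_append, List.map_cons, List.map_map, Function.comp_def,
      add_assoc, add_comm s]

namespace IsStackSortable

variable {w : List ℕ}

theorem stackSort_eq (hw : IsStackSortable w) : stackSort w = List.range' 1 w.length := by
  induction hw with
  | nil => exact stackSort_nil
  | @sum u v _ _ hu hv =>
    have hle {x : List ℕ} (hx : stackSort x = List.range' 1 x.length) : ∀ y ∈ x, y ≤ x.length := by
      intro y hy
      rw [← mem_stackSort, hx, List.mem_range'_1] at hy
      omega
    have hvn : v.Nodup := (stackSort_perm v).nodup_iff.1 (hv ▸ List.nodup_range')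
    have hlen : (directSum u (skewSum [1] v)).length = u.length + v.length + 1 := by
      simp [directSum, skewSum, add_assoc, add_comm 1]
    rw [stackSort_directSum_skewSum_singleton (hle hu) (hle hv) hvn, hu, hv, hlen,
      range'_eq_directSum_append]

theorem isPermutation (hw : IsStackSortable w) : IsPermutation w.length w :=
  (stackSort_perm w).symm.trans (.of_eq hw.stackSort_eq)

theorem nodup (hw : IsStackSortable w) : w.Nodup :=
  hw.isPermutation.nodup

theorem le_length (hw : IsStackSortable w) : ∀ y ∈ w, y ≤ w.length :=
  fun _ hy => hw.isPermutation.le_of_mem hy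

theorem le_length_of_reverse (hw : IsStackSortable w.reverse) : ∀ y ∈ w, y ≤ w.length := by
  simpa using hw.le_length

end IsStackSortable

theorem isStackSortable_iff {w : List ℕ} :
    IsStackSortable w ↔ stackSort w = List.range' 1 w.length := by
  refine ⟨IsStackSortable.stackSort_eq, fun h => ?_⟩
  obtain ⟨v, hv, rfl⟩ := exists_isStackSortable_of_stackSort_eq (s := 0) (by rwa [zero_add])
  simpa using hv

namespace IsStackSortable

variable {w : List ℕ}

theorem reverse_bijP (hw : IsStackSortable w) : IsStackSortable (bijP w).reverse := by
  induction hw with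
  | nil =>
    rw [bijP_nil]
    exact nil
  | sum hu hv ihu ihv =>
    rw [bijP_directSum_skewSum_singleton hu.le_length hv.le_length, reverse_skewSum,
      reverse_directSum]
    exact .sum ihv ihu

theorem sameShape_bijP (hw : IsStackSortable w) : SameShape w (bijP w) := by
  induction hw with
  | nil => simpa only [bijP_nil] using SameShape.nil
  | sum hu hv ihu ihv =>
    rw [bijP_directSum_skewSum_singleton hu.le_length hv.le_length]
    exact .directSum_skewSum hu.le_length hv.le_length hu.reverse_bijP.le_length_of_reverse
      hv.reverse_bijP.le_length_of_reverse ihu ihv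

theorem nodup_bijP (hw : IsStackSortable w) : (bijP w).Nodup :=
  List.nodup_reverse.1 hw.reverse_bijP.nodup

end IsStackSortable

theorem bijP_injOn : Set.InjOn bijP {w | IsStackSortable w} := by
  intro w hw w' hw' h
  induction hw generalizing w' with
  | nil =>
    have hlen := hw'.sameShape_bijP.length_eq
    rw [← h, bijP_nil] at hlen
    exact (List.eq_nil_of_length_eq_zero hlen).symm
  | sum hu hv ihu ihv =>
    cases hw' with
    | nil =>
      have hlen := (hu.sum hv).sameShape_bijP.length_eq
      rw [h, bijP_nil] at hlen
      exact List.eq_nil_of_length_eq_zero hlen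
    | sum hu' hv' =>
      rw [bijP_directSum_skewSum_singleton hu.le_length hv.le_length,
        bijP_directSum_skewSum_singleton hu'.le_length hv'.le_length] at h
      obtain ⟨huu', hvv'⟩ := skewSum_directSum_singleton_inj
        hu.reverse_bijP.le_length_of_reverse hv.reverse_bijP.le_length_of_reverse
        hu'.reverse_bijP.le_length_of_reverse hv'.reverse_bijP.le_length_of_reverse h
      rw [ihu hu' huu', ihv hv' hvv']

theorem bijP_bijOn : Set.BijOn bijP {w | IsStackSortable w} {w | IsStackSortable w.reverse} := by
  suffices h : ∀ w, IsStackSortable w → w.reverse ∈ bijP '' {w | IsStackSortable w} from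
    ⟨fun w hw => hw.reverse_bijP, bijP_injOn, fun v hv => v.reverse_reverse ▸ h _ hv⟩
  intro w hw
  induction hw with
  | nil => exact ⟨[], .nil, bijP_nil⟩
  | sum _ _ ihu ihv =>
    obtain ⟨u, hu, hu'⟩ := ihu
    obtain ⟨v, hv, hv'⟩ := ihv
    refine ⟨_, .sum hv hu, ?_⟩
    rw [bijP_directSum_skewSum_singleton hv.le_length hu.le_length, hu', hv', reverse_directSum,
      reverse_skewSum]
    rfl

theorem IsStackSortable.map_relabeling {w : List ℕ} (hw : IsStackSortable w) :
    w.map (relabeling w) = bijP w := by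
  refine List.ext_getElem (by rw [List.length_map, hw.sameShape_bijP.length_eq])
    fun i hi hi' => ?_
  rw [List.length_map] at hi
  rw [List.getElem_map, relabeling, hw.nodup.idxOf_getElem i hi, List.getD_eq_getElem _ _ hi']

theorem IsStackSortable.sameShape_map_relabeling {w : List ℕ} (hw : IsStackSortable w) :
    SameShape w (w.map (relabeling w)) :=
  hw.map_relabeling ▸ hw.sameShape_bijP

theorem IsStackSortable.exists_leftInvOn_relabeling {w : List ℕ} (hw : IsStackSortable w) :
    ∃ g, Set.LeftInvOn g (relabeling w) {x | x ∈ w} :=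
  exists_leftInvOn_of_nodup_map (hw.map_relabeling ▸ hw.nodup_bijP)

section Phi

variable {A : List ℕ → List ℕ} {n : ℕ} {θ : List ℕ} (hA : IsComposition A)
include hA

theorem mem_sortedBy_stackSort_comp_iff :
    θ ∈ sortedBy n (stackSort ∘ A) ↔ IsPermutation n θ ∧ IsStackSortable (A θ) := by
  refine and_congr_right fun hθ => ?_
  rw [isStackSortable_iff, (hA.perm θ).length_eq, hθ.length_eq, Function.comp_apply]

theorem sameShape_Phi (hθ : θ ∈ sortedBy n (stackSort ∘ A)) : SameShape θ (Phi A θ) := by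
  rw [mem_sortedBy_stackSort_comp_iff hA] at hθ
  exact hA.sameShape_of_apply hθ.1.nodup hθ.2.sameShape_map_relabeling

theorem apply_Phi (hθ : θ ∈ sortedBy n (stackSort ∘ A)) : A (Phi A θ) = bijP (A θ) := by
  rw [mem_sortedBy_stackSort_comp_iff hA] at hθ
  rw [Phi, hA.apply_map hθ.1.nodup hθ.2.sameShape_map_relabeling, hθ.2.map_relabeling]

theorem Phi_mapsTo :
    Set.MapsTo (Phi A) (sortedBy n (stackSort ∘ A)) (sortedBy n (stackSort ∘ reversal ∘ A)) := by
  intro θ hθ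
  have hPhi := apply_Phi hA hθ
  rw [mem_sortedBy_stackSort_comp_iff hA] at hθ
  rw [mem_sortedBy_stackSort_comp_iff hA.reversal_comp, Function.comp_apply, hPhi]
  have hlen : (bijP (A θ)).reverse.length = n := by
    rw [List.length_reverse, ← hθ.2.sameShape_bijP.length_eq, (hA.perm θ).length_eq,
      hθ.1.length_eq]
  refine ⟨?_, hθ.2.reverse_bijP⟩
  have hperm := (hPhi ▸ hA.perm (Phi A θ)).symm.trans (List.reverse_perm _).symm
  exact hperm.trans (hlen ▸ hθ.2.reverse_bijP.isPermutation)

theorem Phi_injOn : Set.InjOn (Phi A) (sortedBy n (stackSort ∘ A)) := by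
  intro θ hθ η hη h
  have hbij : bijP (A θ) = bijP (A η) := by rw [← apply_Phi hA hθ, ← apply_Phi hA hη, h]
  rw [mem_sortedBy_stackSort_comp_iff hA] at hθ hη
  have hAθη : A θ = A η := bijP_injOn hθ.2 hη.2 hbij
  obtain ⟨g, hg⟩ := hη.2.exists_leftInvOn_relabeling
  have hgη : (Phi A η).map g = η :=
    map_map_of_leftInvOn fun x hx => hg ((hA.perm η).mem_iff.2 hx)
  have hgθ : (Phi A θ).map g = θ := by
    rw [Phi, hAθη]
    exact map_map_of_leftInvOn fun x hx => hg (hAθη ▸ (hA.perm θ).mem_iff.2 hx)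
  rw [← hgθ, h, hgη]

theorem Phi_surjOn :
    Set.SurjOn (Phi A) (sortedBy n (stackSort ∘ A)) (sortedBy n (stackSort ∘ reversal ∘ A)) := by
  intro η hη
  rw [mem_sortedBy_stackSort_comp_iff hA.reversal_comp] at hη
  obtain ⟨w, hw : IsStackSortable w, hwη : bijP w = A η⟩ := bijP_bijOn.surjOn hη.2
  obtain ⟨g, hg⟩ := hw.exists_leftInvOn_relabeling
  rw [← hw.map_relabeling] at hwη
  have hgη : (A η).map g = w := by rw [← hwη, map_map_of_leftInvOn hg]
  have hshape : SameShape (A η) ((A η).map g) := by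
    rw [hgη, ← hwη]
    exact hw.sameShape_map_relabeling.symm
  have hAg : A (η.map g) = w := (hA.apply_map hη.1.nodup hshape).trans hgη
  have hmem : IsPermutation n (η.map g) := by
    have hlen : w.length = n := by
      rw [← hgη, List.length_map, (hA.perm η).length_eq, hη.1.length_eq]
    exact (hAg ▸ hA.perm (η.map g)).symm.trans (hlen ▸ hw.isPermutation)
  refine ⟨η.map g, (mem_sortedBy_stackSort_comp_iff hA).2 ⟨hmem, hAg ▸ hw⟩, ?_⟩
  rw [Phi, hAg]
  refine map_map_of_leftInvOn fun x hx => ?_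
  have hx' : x ∈ w.map (relabeling w) := hwη ▸ (hA.perm η).mem_iff.2 hx
  obtain ⟨z, hz, rfl⟩ := List.mem_map.1 hx'
  rw [hg hz]

theorem Phi_bijOn :
    Set.BijOn (Phi A) (sortedBy n (stackSort ∘ A)) (sortedBy n (stackSort ∘ reversal ∘ A)) :=
  ⟨Phi_mapsTo hA, Phi_injOn hA, Phi_surjOn hA⟩

end Phi

theorem equidistributed_of_bijOn {T : Type*} {f : List ℕ → T} {F : List ℕ → List ℕ}
    {X Y : Set (List ℕ)} (hF : Set.BijOn F X Y) (hf : PreservedBy F f X) :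
    Equidistributed f X Y := by
  intro v
  have hv : {θ ∈ X | f θ = v} = X ∩ F ⁻¹' {θ ∈ Y | f θ = v} := by
    ext θ
    refine and_congr_right fun hθ => ?_
    rw [Set.mem_preimage, Set.mem_sep_iff, hf θ hθ, and_iff_right (hF.mapsTo hθ)]
  rw [hv]
  exact (hF.subset_right (Set.sep_subset Y _)).ncard_eq

theorem transferred_of_preservedBy {T : Type*} {f : List ℕ → T} {A : List ℕ → List ℕ} {n : ℕ}
    (hA : IsComposition A) (hf : PreservedBy (Phi A) f (sortedBy n (stackSort ∘ A))) :
    Transferred n A f :=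
  ⟨equidistributed_of_bijOn (Phi_bijOn hA) hf, hf⟩

section Statistics

variable {w w' : List ℕ} {i : ℕ}

theorem entry_add_one (h : i < w.length) : entry w (i + 1) = w[i] := by
  rw [entry, Nat.add_sub_cancel, List.getD_eq_getElem _ _ h]

theorem forall_lt_entry_iff_take (h : i < w.length) :
    (∀ j < i + 1, 1 ≤ j → entry w j < entry w (i + 1)) ↔ ∀ y ∈ w.take i, y < w[i] := by
  rw [entry_add_one h]
  constructor
  · intro H y hy
    obtain ⟨k, hk, rfl⟩ := List.mem_take_iff_getElem.1 hy
    rw [← entry_add_one]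
    exact H (k + 1) (by omega) (by omega)
  · intro H j hj hj'
    obtain ⟨k, rfl⟩ := Nat.exists_eq_add_of_le' hj'
    rw [entry_add_one (by omega)]
    exact H _ (List.mem_take_iff_getElem.2 ⟨k, by omega, rfl⟩)

theorem forall_lt_entry_iff_drop (h : i < w.length) :
    (∀ j ≤ w.length, i + 1 < j → entry w j < entry w (i + 1)) ↔
      ∀ y ∈ w.drop (i + 1), y < w[i] := by
  rw [entry_add_one h]
  constructor
  · intro H y hy
    obtain ⟨k, hk, rfl⟩ := List.mem_drop_iff_getElem.1 hy
    rw [← entry_add_one]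
    exact H (i + 1 + k + 1) (by omega) (by omega)
  · intro H j hj hj'
    obtain ⟨k, rfl⟩ := Nat.exists_eq_add_of_lt hj'
    rw [entry_add_one (by omega)]
    exact H _ (List.mem_drop_iff_getElem.2 ⟨k, by omega, rfl⟩)

namespace SameShape

variable (h : SameShape w w')
include h

theorem lrMaxPositions_eq : lrMaxPositions w = lrMaxPositions w' := by
  rw [lrMaxPositions, lrMaxPositions, ← h.length_eq]
  refine Finset.filter_congr fun i hi => ?_
  obtain ⟨k, rfl⟩ := Nat.exists_eq_add_of_le' (Finset.mem_Icc.1 hi).1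
  have hk : k < w.length := (Finset.mem_Icc.1 hi).2
  have hk' : k < w'.length := h.length_eq ▸ hk
  have hprefix := h.take (k + 1)
  rw [List.take_succ_eq_append_getElem hk, List.take_succ_eq_append_getElem hk'] at hprefix
  rw [forall_lt_entry_iff_take hk, forall_lt_entry_iff_take hk', hprefix.lt_last_iff]

theorem rlMaxPositions_eq : rlMaxPositions w = rlMaxPositions w' := by
  rw [rlMaxPositions, rlMaxPositions, ← h.length_eq]
  refine Finset.filter_congr fun i hi => ?_
  obtain ⟨k, rfl⟩ := Nat.exists_eq_add_of_le' (Finset.mem_Icc.1 hi).1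
  have hk : k < w.length := (Finset.mem_Icc.1 hi).2
  have hk' : k < w'.length := h.length_eq ▸ hk
  have hsuffix := h.drop k
  rw [List.drop_eq_getElem_cons hk, List.drop_eq_getElem_cons hk'] at hsuffix
  have hmax' := forall_lt_entry_iff_drop hk'
  rw [← h.length_eq] at hmax'
  rw [forall_lt_entry_iff_drop hk, hmax', hsuffix.lt_head_iff]

theorem lrMaxCount_eq : lrMaxCount w = lrMaxCount w' := by
  rw [lrMaxCount, lrMaxCount, h.lrMaxPositions_eq]

theorem rlMaxCount_eq : rlMaxCount w = rlMaxCount w' := by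
  rw [rlMaxCount, rlMaxCount, h.rlMaxPositions_eq]

theorem getElem_lt_getElem_add_one_iff (hi : i + 1 < w.length) (hi' : i + 1 < w'.length) :
    w[i] < w[i + 1] ↔ w'[i] < w'[i + 1] := by
  have hfactor : SameShape ([w[i]] ++ [w[i + 1]]) ([w'[i]] ++ [w'[i + 1]]) := by
    have := (h.drop i).take 2
    rwa [List.drop_eq_getElem_cons (by omega), List.drop_eq_getElem_cons hi,
      List.drop_eq_getElem_cons (l := w') (by omega), List.drop_eq_getElem_cons hi'] at this
  simpa only [List.mem_singleton, forall_eq] using hfactor.lt_last_iff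

theorem upDownWord_eq : upDownWord w = upDownWord w' := by
  rw [upDownWord, upDownWord, ← h.length_eq]
  refine List.map_congr_left fun i hi => ?_
  rw [List.mem_range'_1] at hi
  obtain ⟨k, rfl⟩ := Nat.exists_eq_add_of_le' hi.1
  have hk : k + 1 < w.length := by omega
  have hk' : k + 1 < w'.length := h.length_eq ▸ hk
  rw [entry_add_one hk, entry_add_one hk', entry_add_one (by omega), entry_add_one (by omega)]
  simp only [h.getElem_lt_getElem_add_one_iff hk hk']

end SameShape

end Statistics

section Subwords

variable {l w : List ℕ}

theorem exists_stackSort_eq_append_reverse (hw : w.Nodup) (hs : l.Sublist w)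
    (hl : l.Pairwise (· > ·)) (hlt : ∀ y ∈ w, y ∉ l → ∀ d ∈ l, y < d) :
    ∃ v, stackSort w = v ++ l.reverse := by
  induction w, hw using maxDecomposition_induction generalizing l with
  | nil => exact ⟨[], by simp [List.sublist_nil.1 hs, stackSort_nil]⟩
  | node u m v _ hm _ ihv =>
    rcases l with _ | ⟨d, l⟩
    · exact ⟨_, (List.append_nil _).symm⟩
    obtain ⟨hdl, hl'⟩ := List.pairwise_cons.1 hl
    have hle : ∀ y ∈ u ++ m :: v, y ≤ m := fun y hy =>
      (List.mem_cons.1 (List.perm_middle.mem_iff.1 hy)).elim le_of_eq fun hy => (hm y hy).le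
    obtain rfl : m = d := by
      by_contra hne
      have hmem : m ∉ d :: l := fun h => (List.mem_cons.1 h).elim hne fun h =>
        (hdl m h).not_ge (hle d (hs.subset List.mem_cons_self))
      exact (hlt m (by simp) hmem d List.mem_cons_self).not_ge
        (hle d (hs.subset List.mem_cons_self))
    have hmu : m ∉ u := fun h => (hm m (List.mem_append_left v h)).false
    obtain ⟨t, ht⟩ := ihv (sublist_of_cons_sublist_append_cons hmu hs) hl' fun y hy hyl x hx =>
      hlt y (by simp [hy])
        (List.not_mem_cons_of_ne_of_not_mem (hm y (List.mem_append_right u hy)).ne hyl) x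
        (List.mem_cons_of_mem m hx)
    exact ⟨stackSort u ++ t, by simp [stackSort_append_cons hm, ht]⟩

theorem sublist_stackSort (hw : w.Nodup) (hs : l.Sublist w) (hl : l.Pairwise (· < ·)) :
    l.Sublist (stackSort w) := by
  induction w, hw using maxDecomposition_induction generalizing l with
  | nil => rwa [stackSort_nil]
  | node u m v _ hm ihu ihv =>
    obtain ⟨l₁, l₂, rfl, hs₁, hs₂⟩ := List.sublist_append_iff.1 hs
    obtain ⟨hl₁, hl₂, -⟩ := List.pairwise_append.1 hl
    rw [stackSort_append_cons hm, List.append_assoc]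
    refine (ihu hs₁ hl₁).append ?_
    rcases List.sublist_cons_iff.1 hs₂ with hs₂ | ⟨r, rfl, hr⟩
    · exact (ihv hs₂ hl₂).trans (List.sublist_append_left _ _)
    · obtain rfl : r = [] := List.eq_nil_iff_forall_not_mem.2 fun y hy =>
        (hm y (List.mem_append_right u (hr.subset hy))).asymm
          ((List.pairwise_cons.1 hl₂).1 y hy)
      exact List.sublist_append_right _ _

theorem sublist_iterate_stackSort (hw : w.Nodup) (hs : l.Sublist w) (hl : l.Pairwise (· < ·))
    (k : ℕ) : l.Sublist (stackSort^[k] w) := by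
  induction k with
  | zero => exact hs
  | succ k ih =>
    have hk : IsComposition stackSort^[k] := .iterate (.stackSort_comp .identity) k
    rw [Function.iterate_succ_apply']
    exact sublist_stackSort (hk.nodup_apply hw) ih hl

end Subwords

namespace SameShape

theorem exists_eq_append_singleton {n : ℕ} {u w' : List ℕ} (h : SameShape (u ++ [n + 1]) w')
    (hw : IsPermutation (n + 1) (u ++ [n + 1])) (hw' : IsPermutation (n + 1) w') :
    ∃ u', w' = u' ++ [n + 1] := by
  rcases List.eq_nil_or_concat' w' with rfl | ⟨u', x, rfl⟩
  · simpa using h.length_eq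
  have hlt : ∀ y ∈ u, y < n + 1 := fun y hy =>
    Nat.lt_succ_of_le ((IsPermutation.append_singleton_iff.1 hw).le_of_mem hy)
  exact ⟨u', by rw [hw'.eq_of_forall_lt (h.lt_last_iff.1 hlt)]⟩

theorem exists_eq_append_range' {p k : ℕ} {v w' : List ℕ}
    (h : SameShape (v ++ List.range' (p + 1) k) w')
    (hw : IsPermutation (p + k) (v ++ List.range' (p + 1) k)) (hw' : IsPermutation (p + k) w') :
    ∃ v', w' = v' ++ List.range' (p + 1) k := by
  induction k generalizing w' with
  | zero => exact ⟨w', (List.append_nil w').symm⟩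
  | succ k ih =>
    have hrange : List.range' (p + 1) (k + 1) = List.range' (p + 1) k ++ [p + k + 1] := by
      rw [List.range'_concat, one_mul, add_right_comm]
    rw [hrange, ← List.append_assoc] at h hw
    obtain ⟨u', rfl⟩ := h.exists_eq_append_singleton hw hw'
    have hinit := (h.of_append (by simpa [← add_assoc] using h.length_eq)).1
    obtain ⟨v', rfl⟩ := ih hinit (IsPermutation.append_singleton_iff.1 hw)
      (IsPermutation.append_singleton_iff.1 hw')
    exact ⟨v', by rw [hrange, List.append_assoc]⟩

end SameShape

section Zeil

variable {n : ℕ} {θ : List ℕ} {f : ℕ → ℕ}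

theorem map_range'_eq_of_sublist {k : ℕ} (hk : k ≤ n) (hθ : IsPermutation n θ)
    (hf : IsPermutation n (θ.map f)) (h : SameShape (stackSort θ) ((stackSort θ).map f))
    (hs : (List.range' (n - k + 1) k).reverse.Sublist θ) :
    (List.range' (n - k + 1) k).map f = List.range' (n - k + 1) k := by
  obtain ⟨p, rfl⟩ := Nat.exists_eq_add_of_le' hk
  rw [Nat.add_sub_cancel] at hs ⊢
  have hlt : ∀ y ∈ θ, y ∉ (List.range' (p + 1) k).reverse →
      ∀ d ∈ (List.range' (p + 1) k).reverse, y < d := by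
    intro y hy hyk d hd
    have := hθ.le_of_mem hy
    rw [List.mem_reverse, List.mem_range'_1] at hyk hd
    omega
  obtain ⟨v, hv⟩ := exists_stackSort_eq_append_reverse hθ.nodup hs
    (List.pairwise_reverse.2 List.pairwise_lt_range') hlt
  rw [List.reverse_reverse] at hv
  have hperm := stackSort_perm θ
  have hmap := hperm.map f
  rw [hv] at h hperm hmap
  obtain ⟨v', hv'⟩ := h.exists_eq_append_range' (hperm.trans hθ) (hmap.trans hf)
  rw [List.map_append] at hv'
  exact (List.append_inj' hv' (List.length_map f)).2

theorem zeil_le_zeil_map (hθ : IsPermutation n θ) (hf : IsPermutation n (θ.map f))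
    (h : SameShape (stackSort θ) ((stackSort θ).map f)) : zeil θ ≤ zeil (θ.map f) := by
  rw [zeil, zeil, hθ.length_eq, hf.length_eq]
  refine Nat.findGreatest_mono_left (fun k hs => ?_) n
  have hk : k ≤ n := by simpa [hθ.length_eq] using hs.length_le
  simpa only [List.map_reverse, map_range'_eq_of_sublist hk hθ hf h hs] using hs.map f

theorem Rzeil_le_Rzeil_map {k : ℕ} (hθ : IsPermutation n θ) (hf : IsPermutation n (θ.map f))
    (h : SameShape ((stackSort ∘ reversal ∘ stackSort^[k]) θ)
      (((stackSort ∘ reversal ∘ stackSort^[k]) θ).map f)) : Rzeil θ ≤ Rzeil (θ.map f) := by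
  rw [Rzeil, Rzeil, hθ.length_eq, hf.length_eq]
  refine Nat.findGreatest_mono_left (fun j hs => ?_) n
  have hj : j ≤ n := by simpa [hθ.length_eq] using hs.length_le
  have hperm : ((reversal ∘ stackSort^[k]) θ).Perm θ :=
    (IsComposition.iterate (.stackSort_comp .identity) k).reversal_comp.perm θ
  have hs' : (List.range' (n - j + 1) j).reverse.Sublist ((reversal ∘ stackSort^[k]) θ) :=
    (sublist_iterate_stackSort hθ.nodup hs List.pairwise_lt_range' k).reverse
  rw [← map_range'_eq_of_sublist hj (hperm.trans hθ) ((hperm.map f).trans hf) h hs']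
  exact hs.map f

end Zeil

theorem preservedBy_of_le_map {T : Type*} [PartialOrder T] {A B : List ℕ → List ℕ} {n : ℕ}
    {s : List ℕ → T} (hA : IsComposition A) (hB : IsComposition B)
    (hs : ∀ (θ : List ℕ) (f : ℕ → ℕ), IsPermutation n θ → IsPermutation n (θ.map f) →
      SameShape (B θ) ((B θ).map f) → s θ ≤ s (θ.map f)) :
    PreservedBy (Phi (A ∘ B)) s (sortedBy n (stackSort ∘ A ∘ B)) := by
  intro θ hθ
  have hPhi : IsPermutation n (Phi (A ∘ B) θ) := (Phi_mapsTo (hA.comp hB) hθ).1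
  rw [mem_sortedBy_stackSort_comp_iff (hA.comp hB)] at hθ
  have hshape : SameShape (B θ) ((B θ).map (relabeling ((A ∘ B) θ))) :=
    hA.sameShape_of_apply (hB.nodup_apply hθ.1.nodup) hθ.2.sameShape_map_relabeling
  refine le_antisymm ?_ (hs θ _ hθ.1 hPhi hshape)
  obtain ⟨g, hg⟩ := hθ.2.exists_leftInvOn_relabeling
  have hgθ : (Phi (A ∘ B) θ).map g = θ :=
    map_map_of_leftInvOn fun x hx => hg (((hA.comp hB).perm θ).mem_iff.2 hx)
  have hgB : (B (Phi (A ∘ B) θ)).map g = B θ := by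
    rw [Phi, hB.apply_map hθ.1.nodup hshape]
    exact map_map_of_leftInvOn fun x hx => hg ((hA.perm _).mem_iff.2 hx)
  have hshape' : SameShape (B (Phi (A ∘ B) θ)) ((B (Phi (A ∘ B) θ)).map g) := by
    rw [hgB, Phi, hB.apply_map hθ.1.nodup hshape]
    exact hshape.symm
  simpa only [hgθ] using hs _ g hPhi (hgθ.symm ▸ hθ.1) hshape'

end StackSorting

open StackSorting in
theorem mainTheorem1_general {A : List ℕ → List ℕ} (hA : IsComposition A) (n : ℕ) :
    Set.BijOn (Phi A) (sortedBy n (stackSort ∘ A)) (sortedBy n (stackSort ∘ reversal ∘ A)) ∧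
      (∀ (T : Type*) (f : List ℕ → T),
        (∀ σ τ : List ℕ, IsPermutation n σ → IsPermutation n τ → SameShape σ τ → f σ = f τ) →
        Transferred n A f) ∧
      (∀ A₀ : List ℕ → List ℕ, IsComposition A₀ → A = A₀ ∘ stackSort → Transferred n A zeil) ∧
      (∀ (B₀ : List ℕ → List ℕ) (k : ℕ), IsComposition B₀ →
        A = B₀ ∘ stackSort ∘ reversal ∘ stackSort^[k] → Transferred n A Rzeil) := by
  refine ⟨Phi_bijOn hA, fun T f hf => transferred_of_preservedBy hA fun θ hθ => ?_, ?_, ?_⟩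
  · exact hf _ _ (Phi_mapsTo hA hθ).1 hθ.1 (sameShape_Phi hA hθ).symm
  · rintro A₀ hA₀ rfl
    exact transferred_of_preservedBy hA (preservedBy_of_le_map hA₀ (.stackSort_comp .identity)
      fun _ _ => zeil_le_zeil_map)
  · rintro B₀ k hB₀ rfl
    have hk : IsComposition stackSort^[k] := .iterate (.stackSort_comp .identity) k
    exact transferred_of_preservedBy hA (preservedBy_of_le_map hB₀ hk.reversal_comp.stackSort_comp
      fun _ _ => Rzeil_le_Rzeil_map)

theorem mainTheorem1 (A : List ℕ → List ℕ) (hA : StackSorting.IsComposition A) (n : ℕ) :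
    (StackSorting.sortedBy n (StackSorting.stackSort ∘ A)).ncard =
        (StackSorting.sortedBy n
          (StackSorting.stackSort ∘ StackSorting.reversal ∘ A)).ncard ∧
      Set.BijOn (StackSorting.Phi A)
        (StackSorting.sortedBy n (StackSorting.stackSort ∘ A))
        (StackSorting.sortedBy n (StackSorting.stackSort ∘ StackSorting.reversal ∘ A)) ∧
      StackSorting.Transferred n A StackSorting.rlMaxCount ∧
      StackSorting.Transferred n A StackSorting.rlMaxPositions ∧
      StackSorting.Transferred n A StackSorting.lrMaxCount ∧
      StackSorting.Transferred n A StackSorting.lrMaxPositions ∧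
      StackSorting.Transferred n A StackSorting.upDownWord ∧
      (∀ (T : Type*) (f : List ℕ → T),
        (∀ σ τ : List ℕ, StackSorting.IsPermutation n σ → StackSorting.IsPermutation n τ →
          StackSorting.upDownWord σ = StackSorting.upDownWord τ → f σ = f τ) →
        StackSorting.Transferred n A f) ∧
      (∀ A₀ : List ℕ → List ℕ, StackSorting.IsComposition A₀ →
        A = A₀ ∘ StackSorting.stackSort →
        StackSorting.Transferred n A StackSorting.zeil) ∧
      (∀ (B₀ : List ℕ → List ℕ) (k : ℕ), StackSorting.IsComposition B₀ → 1 ≤ k →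
        A = B₀ ∘ StackSorting.stackSort ∘ StackSorting.reversal ∘ StackSorting.stackSort^[k] →
        StackSorting.Transferred n A StackSorting.Rzeil) := by
  obtain ⟨hbij, hshape, hzeil, hRzeil⟩ := mainTheorem1_general hA n
  have htransfer := fun T => (mainTheorem1_general hA n).2.1 T
  exact ⟨hbij.ncard_eq, hbij, htransfer _ _ fun _ _ _ _ h => h.rlMaxCount_eq,
    htransfer _ _ fun _ _ _ _ h => h.rlMaxPositions_eq,
    htransfer _ _ fun _ _ _ _ h => h.lrMaxCount_eq,
    htransfer _ _ fun _ _ _ _ h => h.lrMaxPositions_eq,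
    htransfer _ _ fun _ _ _ _ h => h.upDownWord_eq,
    fun T f hf => hshape T f fun σ τ hσ hτ h => hf σ τ hσ hτ h.upDownWord_eq,
    hzeil, fun B₀ k hB₀ _ => hRzeil B₀ k hB₀⟩
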